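/- **Setting.** Let $d\ge 1$, $n=(n_1,\dots,n_d)$, $r=(r_1,\dots,r_d)$; tensors in $\mathbb R^{n_1\times\dots\times n_d}$ carry the Euclidean (Frobenius) norm $\|\cdot\|$. Let $\mathrm{mat}_i$ be the mode-$i$ matricization (row index $=$ $i$-th index, columns $=$ all other indices), $\mathrm{ten}_i$ its inverse, and $\times_i$ the mode-$i$ product. Let $\mathcal M_i=\{Y:\operatorname{rank}\mathrm{mat}_i(Y)=r_i\}$, with tangent space $T_Y\mathcal M_i$ at $Y$. **The nested Tucker integrator.** One step from $t_a$ to $t_b=t_a+h$ takes a Tucker tensor $C\times_{1}U_1\cdots\times_d U_d$ ($C\in\mathbb R^{r_1\times\dots\times r_d}$, $U_i\in\mathbb R^{n_i\times r_i}$ with orthonormal columns) to another one as follows. For $i=1,\dots,d$, with $U_k$ already updated for $k<i$ and not yet for $k\ge i$: - take a QR factorization $\mathrm{mat}_i(C)^T=Q_iS_i^{T}$ and put $V_i^{T}=Q_i^{T}\bigl(\bigotimes_{k<i}I_{r_k}\otimes\bigotimes_{k>i}U_k^{T}\bigr)$ and $F_i(t,Y)=\mathrm{mat}_i\bigl(F(t,\mathrm{ten}_i(Y)\times_{k<i}U_k)\times_{k<i}U_k^T\bigr)$;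 - (K-step) solve $\dot K=F_i(t,KV_i^T)V_i$, $K(t_a)=U_iS_i$, on $[t_a,t_b]$ and take a QR factorization $K(t_b)=U_i^1\widehat S_i$; - (S-step) solve $\dot S=-U_i^{1,T}F_i(t,U_i^1SV_i^T)V_i$, $S(t_a)=\widehat S_i$, on $[t_a,t_b]$; - replace $C$ by $\mathrm{ten}_i(S(t_b)Q_i^T)$ and $U_i$ by $U_i^1$. After mode $d$, solve $\dot L^T=U_d^{T}F_d(t,U_dL^T)$, $L^T(t_a)=\mathrm{mat}_d(C)$, on $[t_a,t_b]$ (with the updated $U_1,\dots,U_d$), and replace $C$ by $\mathrm{ten}_d(L^T(t_b))$. All substeps are solved exactly. The integrator is started at $t_0$ from a Tucker decomposition of $Y_0=A(t_0)$ with orthonormal basis matrices, and $Y_N$ denotes the tensor obtained after $N$ steps. **Theorem.** For all $d$, $L$, $B$ and $\tau$ there are constants $c_1,c_2>0$, depending only on these four numbers, such that the following holds. Let $T-t_0=\tau$, $\varepsilon\ge0$, $\rho>0$, let $F:\mathbb R\times\mathbb R^{n_1\times\dots\times n_d}\to\mathbb R^{n_1\times\dots\times n_d}$, and let $A$ solve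 $\dot A(t)=F(t,A(t))$ on $[t_0,T]$. Assume: 1. $\|F(t,Y)-F(t,\widetilde Y)\|\le L\|Y-\widetilde Y\|$ and $\|F(t,Y)\|\le B$ for all $t\in[t_0,T]$ and all $Y,\widetilde Y$; 2. for each $i=1,\dots,d$, each $t\in[t_0,T]$ and each $Y\in\mathcal M_i$ with $\|Y-A(t)\|<\rho$ there is a decomposition $F(t,Y)=M_i+R_i$ with $M_i\in T_Y\mathcal M_i$ and $\|R_i\|\le\varepsilon$; 3. $A(t_0)$ has multilinear rank $r$, that is, $\operatorname{rank}\mathrm{mat}_i(A(t_0))=r_i$ for all $i$. Then for every step size $h>0$ and every $N\ge 0$ with $t_N=t_0+Nh\le T$, and with $h,\varepsilon$ so small that $c_1h+c_2\varepsilon\le\rho$, the nested Tucker integrator satisfies $$\|Y_N-A(t_N)\|\le c_1h+c_2\varepsilon .$$ In particular the constants do not depend on $n$, $r$, $F$, $A$, $\rho$, or on the singular values of the matricizations of the exact or the approximate solution. -/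

import Mathlib

open scoped Matrix Kronecker Topology

noncomputable section

/-- Real tensors of size `n 0 × ⋯ × n (d - 1)`, with the Euclidean (Frobenius) norm. -/
abbrev Tensor {d : ℕ} (n : Fin d → ℕ) : Type :=
  EuclideanSpace ℝ ((k : Fin d) → Fin (n k))

/-- Multi-indices over the modes `k < i`. -/
abbrev LowIdx {d : ℕ} (n : Fin d → ℕ) (i : Fin d) : Type :=
  (k : {k : Fin d // k < i}) → Fin (n k)

/-- Multi-indices over the modes `k > i`. -/
abbrev UpIdx {d : ℕ} (n : Fin d → ℕ) (i : Fin d) : Type :=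
  (k : {k : Fin d // i < k}) → Fin (n k)

/-- A multi-index is the same as its `i`-th entry together with its entries in the modes
`k < i` and in the modes `k > i`. -/
def splitIdx {d : ℕ} (n : Fin d → ℕ) (i : Fin d) :
    ((k : Fin d) → Fin (n k)) ≃ Fin (n i) × (LowIdx n i × UpIdx n i) where
  toFun x := (x i, (fun k => x k, fun k => x k))
  invFun y := fun k =>
    if h₁ : k < i then y.2.1 ⟨k, h₁⟩
    else if h₂ : i < k then y.2.2 ⟨k, h₂⟩
    else Fin.cast (congrArg n (le_antisymm (not_lt.mp h₁) (not_lt.mp h₂))) y.1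
  left_inv x := by
    funext k
    by_cases h₁ : k < i
    · simp [h₁]
    · by_cases h₂ : i < k
      · simp [h₁, h₂]
      · obtain rfl : i = k := le_antisymm (not_lt.mp h₁) (not_lt.mp h₂)
        simp
  right_inv y := by
    obtain ⟨a, p, q⟩ := y
    refine Prod.ext ?_ (Prod.ext ?_ ?_)
    · simp
    · funext k
      simp [k.2]
    · funext k
      simp [k.2, not_lt.mpr k.2.le]

/-- The mode-`i` matricization: its columns are the mode-`i` unfolded entries, one column for
each choice of the indices in all the modes other than `i`. -/
def mat {d : ℕ} {n : Fin d → ℕ} (i : Fin d) (X : Tensor n) :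
    Matrix (Fin (n i)) (LowIdx n i × UpIdx n i) ℝ :=
  Matrix.of fun a p => X ((splitIdx n i).symm (a, p))

/-- The mode-`i` tensorization, the inverse of `mat i`. -/
def ten {d : ℕ} {n : Fin d → ℕ} (i : Fin d)
    (M : Matrix (Fin (n i)) (LowIdx n i × UpIdx n i) ℝ) : Tensor n :=
  WithLp.toLp 2 fun x => M (splitIdx n i x).1 (splitIdx n i x).2

theorem ten_mat {d : ℕ} {n : Fin d → ℕ} (i : Fin d) (X : Tensor n) : ten i (mat i X) = X := by
  ext x
  simp [ten, mat]

theorem mat_ten {d : ℕ} {n : Fin d → ℕ} (i : Fin d)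
    (M : Matrix (Fin (n i)) (LowIdx n i × UpIdx n i) ℝ) : mat i (ten i M) = M := by
  ext a p
  simp [ten, mat]

/-- The Kronecker product of a finite family of matrices. -/
def kronFamily {ι : Type} [Fintype ι] {a b : ι → ℕ}
    (W : (k : ι) → Matrix (Fin (a k)) (Fin (b k)) ℝ) :
    Matrix ((k : ι) → Fin (a k)) ((k : ι) → Fin (b k)) ℝ :=
  Matrix.of fun p q => ∏ k, W k (p k) (q k)

/-- `⨂_{k < i} U k`. -/
def kronLow {d : ℕ} {n r : Fin d → ℕ} (U : (k : Fin d) → Matrix (Fin (n k)) (Fin (r k)) ℝ)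
    (i : Fin d) : Matrix (LowIdx n i) (LowIdx r i) ℝ :=
  kronFamily fun k : {k : Fin d // k < i} => U k

/-- `⨂_{k > i} U k`. -/
def kronUp {d : ℕ} {n r : Fin d → ℕ} (U : (k : Fin d) → Matrix (Fin (n k)) (Fin (r k)) ℝ)
    (i : Fin d) : Matrix (UpIdx n i) (UpIdx r i) ℝ :=
  kronFamily fun k : {k : Fin d // i < k} => U k

/-- `X` has multilinear rank `r`. -/
def HasMultilinearRank {d : ℕ} {n : Fin d → ℕ} (r : Fin d → ℕ) (X : Tensor n) : Prop :=
  ∀ i, (mat i X).rank = r i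

/-- The manifold of the tensors whose mode-`i` unfolding has rank `ρ`. -/
def rankManifold {d : ℕ} (n : Fin d → ℕ) (i : Fin d) (ρ : ℕ) : Set (Tensor n) :=
  {Y | (mat i Y).rank = ρ}

/-- The tangent space at `Y` of a submanifold `M` of a normed space: the velocities at `Y` of
the continuously differentiable curves in `M` through `Y`. -/
def tangentVectors {E : Type*} [NormedAddCommGroup E] [NormedSpace ℝ E] (M : Set E) (Y : E) :
    Set E :=
  {ξ | ∃ γ : ℝ → E, ContDiff ℝ 1 γ ∧ (∀ᶠ s in 𝓝 (0 : ℝ), γ s ∈ M) ∧ γ 0 = Y ∧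
    HasDerivAt γ ξ 0}

/-- A tensor in Tucker format: a core tensor and one basis matrix for each mode. -/
structure TuckerData {d : ℕ} (n r : Fin d → ℕ) where
  core : Tensor r
  basis : (k : Fin d) → Matrix (Fin (n k)) (Fin (r k)) ℝ

/-- The tensor `C ×_{k} U k` represented by the core `C` and the basis matrices `U k`. -/
def TuckerData.toTensor {d : ℕ} {n r : Fin d → ℕ} (X : TuckerData n r) : Tensor n :=
  WithLp.toLp 2 fun x => ∑ l : (k : Fin d) → Fin (r k), X.core l * ∏ k, X.basis k (x k) (l k)

/-- The basis matrices have orthonormal columns. -/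
def TuckerData.Orthonormal {d : ℕ} {n r : Fin d → ℕ} (X : TuckerData n r) : Prop :=
  ∀ k, (X.basis k)ᵀ * X.basis k = 1

/-- `A = Q R` is a (thin) QR factorization. -/
def IsQR {ι : Type} [Fintype ι] {m : ℕ} (A Q : Matrix ι (Fin m) ℝ)
    (R : Matrix (Fin m) (Fin m) ℝ) : Prop :=
  A = Q * R ∧ Qᵀ * Q = 1 ∧ ∀ a b, b < a → R a b = 0

/-- `X` solves the matrix differential equation `X' = G(t, X)` on `[a, b]`. -/
def SolvesMatrixODE {ι κ : Type} (G : ℝ → Matrix ι κ ℝ → Matrix ι κ ℝ) (a b : ℝ)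
    (X : ℝ → Matrix ι κ ℝ) : Prop :=
  ∀ t ∈ Set.Icc a b, ∀ p q,
    HasDerivWithinAt (fun s => X s p q) (G t (X t) p q) (Set.Icc a b) t

/-- The right-hand side of the matrix differential equation treated in mode `i`,
`Y ↦ mat_i (F(t, ten_i(Y) ×_{k<i} U k) ×_{k<i} (U k)ᵀ)`, for matrices `Y` of size
`n i × (r 0 ⋯ r (i - 1) n (i + 1) ⋯ n (d - 1))`. The mode products with `U k`, `k < i`, act on
a mode-`i` unfolding as multiplication from the right by the transpose of
`⨂_{k<i} U k ⊗ ⨂_{k>i} 1`. -/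
def unfoldedField {d : ℕ} {n r : Fin d → ℕ} (F : ℝ → Tensor n → Tensor n)
    (U : (k : Fin d) → Matrix (Fin (n k)) (Fin (r k)) ℝ) (i : Fin d) (t : ℝ)
    (Y : Matrix (Fin (n i)) (LowIdx r i × UpIdx n i) ℝ) :
    Matrix (Fin (n i)) (LowIdx r i × UpIdx n i) ℝ :=
  let W : Matrix (LowIdx n i × UpIdx n i) (LowIdx r i × UpIdx n i) ℝ :=
    kronLow U i ⊗ₖ (1 : Matrix (UpIdx n i) (UpIdx n i) ℝ)
  mat i (F t (ten i (Y * Wᵀ))) * W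

/-- The pass of the loop of the nested Tucker integrator that treats mode `i` on `[a, b]`,
taking the current data `X` to `X'`. In `X` the basis matrices of the modes `k < i` are
already updated and those of the modes `k ≥ i` are not. -/
def ModeStep {d : ℕ} {n r : Fin d → ℕ} (F : ℝ → Tensor n → Tensor n) (a b : ℝ) (i : Fin d)
    (X X' : TuckerData n r) : Prop :=
  ∃ (Q : Matrix (LowIdx r i × UpIdx r i) (Fin (r i)) ℝ) (S₀ Shat : Matrix (Fin (r i)) (Fin (r i)) ℝ)
    (K : ℝ → Matrix (Fin (n i)) (Fin (r i)) ℝ) (S : ℝ → Matrix (Fin (r i)) (Fin (r i)) ℝ)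
    (V : Matrix (LowIdx r i × UpIdx n i) (Fin (r i)) ℝ),
    IsQR (mat i X.core)ᵀ Q S₀ᵀ ∧
    Vᵀ = Qᵀ * ((1 : Matrix (LowIdx r i) (LowIdx r i) ℝ) ⊗ₖ kronUp X.basis i)ᵀ ∧
    -- K-step
    K a = X.basis i * S₀ ∧
    SolvesMatrixODE (fun t K => unfoldedField F X.basis i t (K * Vᵀ) * V) a b K ∧
    IsQR (K b) (X'.basis i) Shat ∧
    -- S-step
    S a = Shat ∧
    SolvesMatrixODE
      (fun t S => -((X'.basis i)ᵀ * unfoldedField F X.basis i t (X'.basis i * S * Vᵀ) * V)) a b S ∧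
    -- update of the core tensor and of the basis matrices
    X'.core = ten i (S b * Qᵀ) ∧
    ∀ k, k ≠ i → X'.basis k = X.basis k

/-- The concluding L-step of the nested Tucker integrator, in the last mode `i`:
`(Lᵀ)' = (U i)ᵀ mat_i (F(t, ten_i (U i Lᵀ) ×_{k<i} U k) ×_{k<i} (U k)ᵀ)`, where `LT` stands for
`Lᵀ`. There is no mode `k > i`, so `kronUp X.basis i` is an empty Kronecker product. -/
def FinalStep {d : ℕ} {n r : Fin d → ℕ} (F : ℝ → Tensor n → Tensor n) (a b : ℝ)
    (X X' : TuckerData n r) : Prop :=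
  ∃ (i : Fin d) (LT : ℝ → Matrix (Fin (r i)) (LowIdx r i × UpIdx r i) ℝ),
    (i : ℕ) + 1 = d ∧
    LT a = mat i X.core ∧
    SolvesMatrixODE
      (fun t LT =>
        (X.basis i)ᵀ *
          (mat i (F t (ten i (X.basis i * LT * (kronLow X.basis i ⊗ₖ kronUp X.basis i)ᵀ))) *
            (kronLow X.basis i ⊗ₖ kronUp X.basis i))) a b LT ∧
    X'.core = ten i (LT b) ∧
    X'.basis = X.basis

/-- One time step of the nested Tucker integrator from time `a` to time `b`: `X'` is a possible
output for the input `X` (the output is determined up to the choice of the QR factorizations). -/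
def NestedTuckerStep {d : ℕ} {n r : Fin d → ℕ} (F : ℝ → Tensor n → Tensor n) (a b : ℝ)
    (X X' : TuckerData n r) : Prop :=
  ∃ Z : Fin (d + 1) → TuckerData n r,
    Z 0 = X ∧
    (∀ i : Fin d, ModeStep F a b i (Z i.castSucc) (Z i.succ)) ∧
    FinalStep F a b (Z (Fin.last d)) X'

/-- `Y 0, …, Y N` are produced by the nested Tucker integrator with step size `h`, started at
time `t₀` from a Tucker decomposition with orthonormal basis matrices of the tensor `Y⁰`. -/
def IsNestedTuckerRun {d : ℕ} {n r : Fin d → ℕ} (F : ℝ → Tensor n → Tensor n) (t₀ h : ℝ)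
    (Y₀ : Tensor n) (N : ℕ) (Y : ℕ → TuckerData n r) : Prop :=
  (Y 0).Orthonormal ∧ (Y 0).toTensor = Y₀ ∧
    ∀ m < N, NestedTuckerStep F (t₀ + m * h) (t₀ + (m + 1) * h) (Y m) (Y (m + 1))

end

/-! Lifted to the full tensor space, the substeps follow projected flows. The K-step solves `Y' =
P_i F`, where `P_i` applies `V_i V_iᵀ` to the columns of the mode-`i` unfolding. The S-step solves
`Y' = -Q_i F`, where `Q_i` applies `U_i U_iᵀ` to the rows as well. The L-step solves `Y' = G_d F`,
where `G_j` (`lowProj`) projects the modes `k < j` onto the ranges of the new bases. All these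
operators are contractions.

Since the range of `V_i` lies in the range of the projection used by `G_i` on the columns, `P_i -
Q_i` equals `G_i - G_{i+1}` up to a contraction of `N_i : X ↦ (1 - U_i U_iᵀ) X (1 - V_i V_iᵀ)`
(`norm_mode_residual_le`). Hence the operators of one step sum to the identity up to the defects
`N_i F`.

The K-step ends at `U_i S V_iᵀ` with exactly these `U_i` and `V_i`, so `N_i` kills the tangential
part of `F` there and leaves at most `ε` (`norm_sandwich_compl_le`). Neither the size nor the
invertibility of `S` matters, so singular values never enter.

Every substep moves by at most `B h`; freezing the argument of `F` therefore costs `O(L B h)`. The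
error obeys `e ↦ e + h (d ε + L e + O(h))` (`SplittingCurves.norm_sub_le`), and a discrete Gronwall
argument concludes. -/

noncomputable section

/-! ### Unfoldings, multilinear products and projections in the low modes. -/

section Unfolding

variable {d : ℕ} {m n r : Fin d → ℕ}

theorem mat_apply (i : Fin d) (X : Tensor n) (x : (k : Fin d) → Fin (n k)) :
    mat i X (splitIdx n i x).1 (splitIdx n i x).2 = X x := by
  simp [mat]

theorem mat_injective (i : Fin d) : Function.Injective (mat (n := n) i) :=
  Function.LeftInverse.injective (ten_mat i)

/-- The matricization as a linear equivalence. -/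
def matEquiv (n : Fin d → ℕ) (i : Fin d) :
    Tensor n ≃ₗ[ℝ] Matrix (Fin (n i)) (LowIdx n i × UpIdx n i) ℝ where
  toFun := mat i
  invFun := ten i
  left_inv := ten_mat i
  right_inv := mat_ten i
  map_add' _ _ := rfl
  map_smul' _ _ := rfl

theorem inner_eq_sum_mat (i : Fin d) (X Y : Tensor n) :
    inner ℝ X Y = ((mat i X)ᵀ * mat i Y).trace := by
  simp only [Matrix.trace, Matrix.diag, Matrix.mul_apply, Matrix.transpose_apply]
  rw [Finset.sum_comm, ← Fintype.sum_prod_type', PiLp.inner_apply]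
  refine Fintype.sum_equiv (splitIdx n i) _ _ fun x => ?_
  simp only [mat_apply]
  simp [mul_comm]

/-- `X ↦ ten_i (P mat_i(X) R)`. -/
def sandwich (i : Fin d) (P : Matrix (Fin (n i)) (Fin (n i)) ℝ)
    (R : Matrix (LowIdx n i × UpIdx n i) (LowIdx n i × UpIdx n i) ℝ) :
    Tensor n →ₗ[ℝ] Tensor n where
  toFun X := ten i (P * mat i X * R)
  map_add' X Y := by
    change ten i (P * (mat i X + mat i Y) * R) = _
    rw [Matrix.mul_add, Matrix.add_mul]
    rfl
  map_smul' c X := by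
    change ten i (P * (c • mat i X) * R) = _
    rw [Matrix.mul_smul, Matrix.smul_mul]
    rfl

variable {i : Fin d} {P P' : Matrix (Fin (n i)) (Fin (n i)) ℝ}
  {R R' : Matrix (LowIdx n i × UpIdx n i) (LowIdx n i × UpIdx n i) ℝ}

theorem mat_sandwich (X : Tensor n) : mat i (sandwich i P R X) = P * mat i X * R :=
  mat_ten i _

theorem sandwich_sandwich (X : Tensor n) :
    sandwich i P R (sandwich i P' R' X) = sandwich i (P * P') (R' * R) X := by
  apply mat_injective i
  simp only [mat_sandwich, Matrix.mul_assoc]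

/-- A sandwich of orthogonal projections is a contraction. -/
theorem norm_sandwich_le (hP : Pᵀ = P) (hPP : P * P = P) (hR : Rᵀ = R) (hRR : R * R = R)
    (X : Tensor n) : ‖sandwich i P R X‖ ≤ ‖X‖ := by
  have hinner : inner ℝ (sandwich i P R X) (sandwich i P R X) =
      inner ℝ X (sandwich i P R X) := by
    simp only [inner_eq_sum_mat i, mat_sandwich, Matrix.transpose_mul, hP, hR]
    calc (R * ((mat i X)ᵀ * P) * (P * mat i X * R)).trace
        = (R * ((mat i X)ᵀ * (P * P) * mat i X * R)).trace := by
          simp only [Matrix.mul_assoc]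
      _ = ((mat i X)ᵀ * P * mat i X * (R * R)).trace := by
          rw [hPP, Matrix.trace_mul_comm]
          simp only [Matrix.mul_assoc]
      _ = _ := by rw [hRR]; simp only [Matrix.mul_assoc]
  rw [real_inner_self_eq_norm_sq] at hinner
  have hcs := real_inner_le_norm X (sandwich i P R X)
  by_contra! hlt
  nlinarith [norm_nonneg X]

theorem prod_eq_mul_prod_lt_mul_prod_gt (f : Fin d → ℝ) (i : Fin d) :
    ∏ k, f k = f i * ((∏ k : {k : Fin d // k < i}, f k) * ∏ k : {k : Fin d // i < k}, f k) := by
  rw [← Finset.prod_subtype (Finset.univ.filter (· < i)) (by simp) f,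
    ← Finset.prod_subtype (Finset.univ.filter (i < ·)) (by simp) f,
    ← Finset.mul_prod_erase Finset.univ f (Finset.mem_univ i),
    ← Finset.prod_union]
  · congr 2
    ext k
    simp [lt_or_lt_iff_ne]
  · rw [Finset.disjoint_filter]
    exact fun k _ h h' => lt_asymm h h'

theorem kronFamily_mul {ι : Type} [Fintype ι] [DecidableEq ι] {a b c : ι → ℕ}
    (W : (k : ι) → Matrix (Fin (a k)) (Fin (b k)) ℝ)
    (W' : (k : ι) → Matrix (Fin (b k)) (Fin (c k)) ℝ) :
    kronFamily W * kronFamily W' = kronFamily fun k => W k * W' k := by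
  ext p q
  simp only [kronFamily, Matrix.mul_apply, Matrix.of_apply, Finset.prod_univ_sum,
    Fintype.piFinset_univ, Finset.prod_mul_distrib]

theorem kronFamily_one {ι : Type} [Fintype ι] [DecidableEq ι] {a : ι → ℕ} :
    (kronFamily fun k : ι => (1 : Matrix (Fin (a k)) (Fin (a k)) ℝ)) = 1 := by
  ext p q
  simp only [kronFamily, Matrix.of_apply, Matrix.one_apply]
  by_cases h : p = q
  · simp [h]
  · obtain ⟨k, hk⟩ := Function.ne_iff.mp h
    rw [if_neg h]
    exact Finset.prod_eq_zero (Finset.mem_univ k) (if_neg hk)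

theorem kronFamily_transpose {ι : Type} [Fintype ι] {a b : ι → ℕ}
    (W : (k : ι) → Matrix (Fin (a k)) (Fin (b k)) ℝ) :
    (kronFamily W)ᵀ = kronFamily fun k => (W k)ᵀ := rfl

/-- The multilinear product `C ×_k W k` over all modes `k`. -/
def modeMul (W : (k : Fin d) → Matrix (Fin (m k)) (Fin (n k)) ℝ) : Tensor n →ₗ[ℝ] Tensor m :=
  Matrix.toEuclideanLin (kronFamily W)

theorem modeMul_apply (W : (k : Fin d) → Matrix (Fin (m k)) (Fin (n k)) ℝ) (C : Tensor n)
    (x : (k : Fin d) → Fin (m k)) : modeMul W C x = ∑ l, (∏ k, W k (x k) (l k)) * C l := rfl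

theorem modeMul_modeMul (W : (k : Fin d) → Matrix (Fin (m k)) (Fin (n k)) ℝ)
    (W' : (k : Fin d) → Matrix (Fin (n k)) (Fin (r k)) ℝ) (C : Tensor r) :
    modeMul W (modeMul W' C) = modeMul (fun k => W k * W' k) C := by
  rw [modeMul, modeMul, modeMul, ← kronFamily_mul]
  ext x
  simp [Matrix.mulVec_mulVec]

theorem modeMul_one (C : Tensor n) :
    modeMul (fun k => (1 : Matrix (Fin (n k)) (Fin (n k)) ℝ)) C = C := by
  rw [modeMul, kronFamily_one]
  ext x
  simp

theorem TuckerData.toTensor_eq_modeMul (X : TuckerData n r) :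
    X.toTensor = modeMul X.basis X.core := by
  ext x
  rw [modeMul_apply]
  simp [TuckerData.toTensor, mul_comm]

theorem mat_modeMul (W : (k : Fin d) → Matrix (Fin (m k)) (Fin (n k)) ℝ) (i : Fin d)
    (C : Tensor n) :
    mat i (modeMul W C) = W i * mat i C * (kronLow W i ⊗ₖ kronUp W i)ᵀ := by
  ext a p
  obtain ⟨x, hx⟩ := (splitIdx m i).surjective (a, p)
  obtain ⟨rfl, rfl⟩ : (splitIdx m i x).1 = a ∧ (splitIdx m i x).2 = p := by simp [hx]
  rw [mat_apply, modeMul_apply]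
  simp only [Matrix.mul_apply, Finset.sum_mul]
  rw [Finset.sum_comm, ← Fintype.sum_prod_type']
  refine Fintype.sum_equiv (splitIdx n i) _ _ fun l => ?_
  rw [mat_apply, prod_eq_mul_prod_lt_mul_prod_gt _ i]
  simp only [Matrix.transpose_apply, Matrix.kroneckerMap_apply, kronLow, kronUp, kronFamily,
    Matrix.of_apply, splitIdx, Equiv.coe_fn_mk]
  ring

theorem transpose_mul_kronLow {U : (k : Fin d) → Matrix (Fin (n k)) (Fin (r k)) ℝ}
    (hU : ∀ k, (U k)ᵀ * U k = 1) (i : Fin d) : (kronLow U i)ᵀ * kronLow U i = 1 := by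
  rw [kronLow, kronFamily_transpose, kronFamily_mul]
  simp only [hU, kronFamily_one]

theorem transpose_mul_kronUp {U : (k : Fin d) → Matrix (Fin (n k)) (Fin (r k)) ℝ}
    (hU : ∀ k, (U k)ᵀ * U k = 1) (i : Fin d) : (kronUp U i)ᵀ * kronUp U i = 1 := by
  rw [kronUp, kronFamily_transpose, kronFamily_mul]
  simp only [hU, kronFamily_one]

/-- The matrix `⨂_{k<i} U k ⊗ ⨂_{k>i} 1`. -/
def lowBasis (U : (k : Fin d) → Matrix (Fin (n k)) (Fin (r k)) ℝ) (i : Fin d) :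
    Matrix (LowIdx n i × UpIdx n i) (LowIdx r i × UpIdx n i) ℝ :=
  kronLow U i ⊗ₖ (1 : Matrix (UpIdx n i) (UpIdx n i) ℝ)

theorem transpose_mul_lowBasis {U : (k : Fin d) → Matrix (Fin (n k)) (Fin (r k)) ℝ}
    (hU : ∀ k, (U k)ᵀ * U k = 1) (i : Fin d) : (lowBasis U i)ᵀ * lowBasis U i = 1 := by
  rw [lowBasis, ← Matrix.kroneckerMap_transpose, ← Matrix.mul_kronecker_mul,
    transpose_mul_kronLow hU, Matrix.transpose_one, Matrix.one_mul, Matrix.one_kronecker_one]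

/-- The projection of the tensors in the modes `k < j` onto the ranges of the `U k`. -/
def lowProj (U : (k : Fin d) → Matrix (Fin (n k)) (Fin (r k)) ℝ) (j : ℕ) :
    Tensor n →ₗ[ℝ] Tensor n :=
  modeMul fun k => if (k : ℕ) < j then U k * (U k)ᵀ else 1

theorem lowProj_zero (U : (k : Fin d) → Matrix (Fin (n k)) (Fin (r k)) ℝ) (X : Tensor n) :
    lowProj U 0 X = X := by
  simp [lowProj, modeMul_one]

/-- Whether mode `i` itself is projected does not affect the factor acting on the other modes, so
`G_i` and `G_{i+1}` share their column projection. This is what makes their difference a single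
sandwich. -/
theorem kron_lowProj (U : (k : Fin d) → Matrix (Fin (n k)) (Fin (r k)) ℝ) (i : Fin d) (j : ℕ)
    (hj : j = i ∨ j = i + 1) :
    let W : (k : Fin d) → Matrix (Fin (n k)) (Fin (n k)) ℝ :=
      fun k => if (k : ℕ) < j then U k * (U k)ᵀ else 1
    (kronLow W i ⊗ₖ kronUp W i)ᵀ = lowBasis U i * (lowBasis U i)ᵀ := by
  intro W
  have h₁ : kronLow W i = kronLow U i * (kronLow U i)ᵀ := by
    rw [kronLow, kronLow, kronFamily_transpose, kronFamily_mul]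
    congr 1
    funext k
    have hk : (k : Fin d).val < i.val := k.2
    exact if_pos (by omega)
  have h₂ : kronUp W i = 1 := by
    rw [kronUp, ← kronFamily_one]
    congr 1
    funext k
    have hk : i.val < (k : Fin d).val := k.2
    exact if_neg (by omega)
  rw [h₁, h₂, lowBasis, ← Matrix.kroneckerMap_transpose, ← Matrix.kroneckerMap_transpose,
    ← Matrix.mul_kronecker_mul]
  simp

theorem lowProj_castSucc (U : (k : Fin d) → Matrix (Fin (n k)) (Fin (r k)) ℝ) (i : Fin d) :
    lowProj U i = sandwich i 1 (lowBasis U i * (lowBasis U i)ᵀ) := by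
  ext1 X
  apply mat_injective i
  rw [lowProj, mat_modeMul, kron_lowProj U i i (Or.inl rfl), mat_sandwich, if_neg (lt_irrefl _)]

theorem lowProj_succ (U : (k : Fin d) → Matrix (Fin (n k)) (Fin (r k)) ℝ) (i : Fin d) :
    lowProj U (i + 1) = sandwich i (U i * (U i)ᵀ) (lowBasis U i * (lowBasis U i)ᵀ) := by
  ext1 X
  apply mat_injective i
  rw [lowProj, mat_modeMul, kron_lowProj U i (i + 1) (Or.inr rfl), mat_sandwich,
    if_pos (Nat.lt_succ_self _)]

end Unfolding

/-! ### Velocities of curves of matrices of bounded rank. -/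

section Tangent

/-- A product rule that needs only continuity of the factor multiplying a vanishing one. It spares
differentiating determinants and adjugates. -/
theorem HasDerivAt.continuousAt_mul_of_eq_zero {f g : ℝ → ℝ} {g' s : ℝ} (hf : ContinuousAt f s)
    (hg : HasDerivAt g g' s) (hgs : g s = 0) : HasDerivAt (fun t => f t * g t) (f s * g') s := by
  rw [hasDerivAt_iff_tendsto_slope] at hg ⊢
  refine ((hf.tendsto.mono_left nhdsWithin_le_nhds).mul hg).congr fun t => ?_
  simp only [slope_def_field, hgs]
  ring

theorem hasDerivAt_mul_mul_apply {α β m n : Type*} [Fintype m] [Fintype n]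
    {G : ℝ → Matrix m n ℝ} {G' : Matrix m n ℝ} {s : ℝ}
    (hG : ∀ p q, HasDerivAt (fun t => G t p q) (G' p q) s) (P : Matrix α m ℝ)
    (Q : Matrix n β ℝ) (a : α) (b : β) :
    HasDerivAt (fun t => (P * G t * Q) a b) ((P * G' * Q) a b) s := by
  simp only [Matrix.mul_apply]
  exact HasDerivAt.fun_sum fun q _ =>
    (HasDerivAt.fun_sum fun p _ => (hG p q).const_mul _).mul_const _

variable {m n : Type*} [Fintype m] [Fintype n] {r : ℕ}

/-- In a matrix of rank at most `r`, the Schur complement of an invertible `r × r` block vanishes. -/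
theorem det_smul_eq_of_rank_le {G : Matrix m n ℝ} (hG : G.rank ≤ r)
    (U : Matrix m (Fin r) ℝ) (V : Matrix n (Fin r) ℝ) (x : Matrix m Unit ℝ)
    (y : Matrix n Unit ℝ) (hdet : (Uᵀ * G * V).det ≠ 0) :
    (Uᵀ * G * V).det • (xᵀ * G * y) =
      xᵀ * G * V * (Uᵀ * G * V).adjugate * (Uᵀ * G * y) := by
  have hM : Matrix.fromBlocks (Uᵀ * G * V) (Uᵀ * G * y) (xᵀ * G * V) (xᵀ * G * y) =
      Matrix.fromRows Uᵀ xᵀ * G * Matrix.fromCols V y := by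
    rw [Matrix.fromRows_mul, Matrix.fromRows_mul_fromCols]
  -- The bordered matrix has size `r + 1` but factors through `G`, so it is singular.
  have h0 : (Matrix.fromBlocks (Uᵀ * G * V) (Uᵀ * G * y) (xᵀ * G * V) (xᵀ * G * y)).det = 0 := by
    by_contra hne
    have hrank := Matrix.rank_of_isUnit _ ((Matrix.isUnit_iff_isUnit_det _).mpr
      (isUnit_iff_ne_zero.mpr hne))
    have hle := (Matrix.rank_mul_le_left (Matrix.fromRows Uᵀ xᵀ * G) (Matrix.fromCols V y)).trans
      (Matrix.rank_mul_le_right _ G)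
    rw [← hM, hrank] at hle
    simp at hle
    omega
  have hu : IsUnit (Uᵀ * G * V).det := isUnit_iff_ne_zero.mpr hdet
  let _ := Matrix.invertibleOfIsUnitDet _ hu
  rw [Matrix.det_fromBlocks₁₁, mul_eq_zero, or_iff_right hdet, Matrix.det_unique,
    Matrix.sub_apply, sub_eq_zero, Matrix.invOf_eq_nonsing_inv, Matrix.inv_def] at h0
  ext i j
  rw [Subsingleton.elim i default, Subsingleton.elim j default, Matrix.smul_apply, h0]
  simp [Ring.inverse_eq_inv', hdet]

/-- Velocities of curves of matrices of bounded rank through `U S Vᵀ`, with `S` invertible, have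
no component in the orthogonal complements of both the column and the row space. -/
theorem compl_mul_mul_compl_eq_zero [DecidableEq m] [DecidableEq n]
    {G : ℝ → Matrix m n ℝ} {G' : Matrix m n ℝ}
    (hG : ∀ p q, HasDerivAt (fun t => G t p q) (G' p q) 0) (hrank : ∀ᶠ s in 𝓝 0, (G s).rank ≤ r)
    {U : Matrix m (Fin r) ℝ} {V : Matrix n (Fin r) ℝ} {S : Matrix (Fin r) (Fin r) ℝ}
    (hU : Uᵀ * U = 1) (hV : Vᵀ * V = 1) (hS : S.det ≠ 0) (h0 : G 0 = U * S * Vᵀ) :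
    (1 - U * Uᵀ) * G' * (1 - V * Vᵀ) = 0 := by
  -- Test `G'` with `x` orthogonal to the range of `U` and `y` orthogonal to that of `V`. The three
  -- bordering blocks vanish at `0`; the Schur identity, cleared of its denominator, is then
  -- differentiated there.
  have key : ∀ (x : Matrix m Unit ℝ) (y : Matrix n Unit ℝ), xᵀ * U = 0 → Vᵀ * y = 0 →
      (xᵀ * G' * y) () () = 0 := by
    intro x y hx hy
    have hA0 : Uᵀ * G 0 * V = S := by
      rw [h0]
      calc Uᵀ * (U * S * Vᵀ) * V = (Uᵀ * U) * S * (Vᵀ * V) := by simp only [Matrix.mul_assoc]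
        _ = S := by rw [hU, hV, Matrix.one_mul, Matrix.mul_one]
    have hC0 : xᵀ * G 0 * V = 0 := by
      rw [h0, ← Matrix.mul_assoc, ← Matrix.mul_assoc, hx]
      simp
    have hB0 : Uᵀ * G 0 * y = 0 := by
      rw [h0, Matrix.mul_assoc, Matrix.mul_assoc, hy]
      simp
    have hD0 : xᵀ * G 0 * y = 0 := by
      rw [h0, Matrix.mul_assoc, Matrix.mul_assoc, hy]
      simp
    have hA : ContinuousAt (fun s => Uᵀ * G s * V) 0 :=
      continuousAt_pi.mpr fun a => continuousAt_pi.mpr fun b =>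
        (hasDerivAt_mul_mul_apply hG Uᵀ V a b).continuousAt
    have hdet : ContinuousAt (fun s => (Uᵀ * G s * V).det) 0 :=
      (Continuous.matrix_det continuous_id).continuousAt.comp (f := fun s => Uᵀ * G s * V) hA
    have hadj : ContinuousAt (fun s => (Uᵀ * G s * V).adjugate) 0 :=
      (Continuous.matrix_adjugate continuous_id).continuousAt.comp
        (f := fun s => Uᵀ * G s * V) hA
    have hL : HasDerivAt (fun s => (Uᵀ * G s * V).det * (xᵀ * G s * y) () ())
        (S.det * (xᵀ * G' * y) () ()) 0 := by
      have := HasDerivAt.continuousAt_mul_of_eq_zero hdet (hasDerivAt_mul_mul_apply hG xᵀ y () ())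
        (by rw [hD0]; rfl)
      rwa [hA0] at this
    -- The right-hand side is a product of two factors vanishing at `0`, hence of second order.
    have hR : HasDerivAt (fun s => (xᵀ * G s * V * (Uᵀ * G s * V).adjugate * (Uᵀ * G s * y)) () ())
        0 0 := by
      have hCadj : ∀ b, ContinuousAt
          (fun s => (xᵀ * G s * V * (Uᵀ * G s * V).adjugate) () b) 0 := by
        intro b
        change Filter.Tendsto (fun s => ∑ c, (xᵀ * G s * V) () c * (Uᵀ * G s * V).adjugate c b) _ _
        refine tendsto_finsetSum _ fun c _ => ?_
        exact (hasDerivAt_mul_mul_apply hG xᵀ V () c).continuousAt.mul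
          (continuousAt_pi.mp (continuousAt_pi.mp hadj c) b)
      have hsum := HasDerivAt.fun_sum (u := Finset.univ) fun b _ =>
        HasDerivAt.continuousAt_mul_of_eq_zero (hCadj b)
          (hasDerivAt_mul_mul_apply hG Uᵀ y b ()) (by rw [hB0]; rfl)
      simp only [hC0, Matrix.zero_mul, Matrix.zero_apply, zero_mul, Finset.sum_const_zero] at hsum
      exact hsum
    have heq : (fun s => (Uᵀ * G s * V).det * (xᵀ * G s * y) () ()) =ᶠ[𝓝 0]
        fun s => (xᵀ * G s * V * (Uᵀ * G s * V).adjugate * (Uᵀ * G s * y)) () () := by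
      filter_upwards [hrank, hdet.eventually_ne (by rwa [hA0])] with s hs hs'
      exact congrFun₂ (det_smul_eq_of_rank_le hs U V x y hs') () ()
    have := hL.unique (hR.congr_of_eventuallyEq heq)
    exact (mul_eq_zero.mp this).resolve_left hS
  ext p q
  -- Row `p` and column `q` of the complementary projections serve as test vectors and yield the
  -- entry `(p, q)`.
  have h := key (Matrix.replicateCol Unit ((1 - U * Uᵀ : Matrix m m ℝ) p))
    (Matrix.replicateCol Unit fun k => (1 - V * Vᵀ : Matrix n n ℝ) k q)
    (by
      have : (1 - U * Uᵀ) * U = 0 := by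
        rw [Matrix.sub_mul, Matrix.mul_assoc, hU, Matrix.one_mul, Matrix.mul_one, sub_self]
      ext a b
      exact congrFun₂ this p b)
    (by
      have : Vᵀ * (1 - V * Vᵀ) = 0 := by
        rw [Matrix.mul_sub, ← Matrix.mul_assoc, hV, Matrix.one_mul, Matrix.mul_one, sub_self]
      ext a b
      exact congrFun₂ this a q)
  exact h

theorem rank_mul_mul_transpose_of_det_ne_zero {U : Matrix m (Fin r) ℝ} {V : Matrix n (Fin r) ℝ}
    {S : Matrix (Fin r) (Fin r) ℝ} (hU : Uᵀ * U = 1) (hV : Vᵀ * V = 1) (hS : S.det ≠ 0) :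
    (U * S * Vᵀ).rank = r := by
  classical
  apply le_antisymm
  · exact (Matrix.rank_mul_le_left _ _).trans ((Matrix.rank_le_card_width _).trans (by simp))
  · have h : Uᵀ * (U * S * Vᵀ * V) = S := by
      rw [Matrix.mul_assoc _ Vᵀ, hV, Matrix.mul_one, ← Matrix.mul_assoc, hU, Matrix.one_mul]
    have hr : S.rank = r := by
      rw [Matrix.rank_of_isUnit _ ((Matrix.isUnit_iff_isUnit_det _).mpr
        (isUnit_iff_ne_zero.mpr hS)), Fintype.card_fin]
    calc r = (Uᵀ * (U * S * Vᵀ * V)).rank := by rw [h, hr]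
      _ ≤ _ := (Matrix.rank_mul_le_right _ _).trans (Matrix.rank_mul_le_left _ _)

/-- The exceptional `η` are eigenvalues of `-S`, hence finitely many. Invertible cores thus
accumulate at every core. -/
theorem eventually_det_add_smul_one_ne_zero (S : Matrix (Fin r) (Fin r) ℝ) :
    ∀ᶠ η : ℝ in 𝓝[≠] 0, (S + η • (1 : Matrix (Fin r) (Fin r) ℝ)).det ≠ 0 := by
  have hfin : {η : ℝ | (-S).charpoly.IsRoot η}.Finite :=
    Polynomial.finite_setOfPred_isRoot (Matrix.charpoly_monic _).ne_zero
  have h' : ∀ᶠ η : ℝ in 𝓝[≠] 0, η ∉ {η : ℝ | (-S).charpoly.IsRoot η} \ {0} := by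
    refine nhdsWithin_le_nhds ((hfin.subset Set.sdiff_subset).isClosed.isOpen_compl.mem_nhds ?_)
    simp
  filter_upwards [h', self_mem_nhdsWithin] with η hη hη0 hdet
  refine hη ⟨?_, hη0⟩
  change Polynomial.eval η _ = 0
  rw [Matrix.eval_charpoly, sub_neg_eq_add, add_comm, ← hdet]
  congr 2
  ext i j
  simp [Matrix.scalar_apply, Matrix.one_apply, Matrix.diagonal_apply]

end Tangent

/-! ### The non-tangential part of the vector field at the end of a K-step. -/

section Defect

variable {d : ℕ} {n : Fin d → ℕ} {i : Fin d} {r : ℕ} {U : Matrix (Fin (n i)) (Fin r) ℝ}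
  {V : Matrix (LowIdx n i × UpIdx n i) (Fin r) ℝ} {S : Matrix (Fin r) (Fin r) ℝ}

theorem transpose_proj {m k : Type*} [Fintype k] (U : Matrix m k ℝ) : (U * Uᵀ)ᵀ = U * Uᵀ := by
  rw [Matrix.transpose_mul, Matrix.transpose_transpose]

theorem proj_mul_proj {m k : Type*} [Fintype m] [Fintype k] [DecidableEq k] {U : Matrix m k ℝ}
    (hU : Uᵀ * U = 1) : U * Uᵀ * (U * Uᵀ) = U * Uᵀ := by
  rw [Matrix.mul_assoc, ← Matrix.mul_assoc Uᵀ, hU, Matrix.one_mul]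

theorem transpose_compl {m k : Type*} [DecidableEq m] [Fintype k] (U : Matrix m k ℝ) :
    (1 - U * Uᵀ)ᵀ = 1 - U * Uᵀ := by
  rw [Matrix.transpose_sub, transpose_proj, Matrix.transpose_one]

theorem compl_mul_compl {m k : Type*} [Fintype m] [DecidableEq m] [Fintype k] [DecidableEq k]
    {U : Matrix m k ℝ} (hU : Uᵀ * U = 1) :
    (1 - U * Uᵀ) * (1 - U * Uᵀ) = 1 - U * Uᵀ := by
  rw [Matrix.mul_sub, Matrix.sub_mul, Matrix.sub_mul, proj_mul_proj hU]
  simp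

theorem sandwich_compl_tangent_eq_zero (hU : Uᵀ * U = 1) (hV : Vᵀ * V = 1) (hS : S.det ≠ 0)
    {M : Tensor n} (hM : M ∈ tangentVectors (rankManifold n i r) (ten i (U * S * Vᵀ))) :
    sandwich i (1 - U * Uᵀ) (1 - V * Vᵀ) M = 0 := by
  obtain ⟨γ, -, hγ, hγ0, hγ'⟩ := hM
  apply mat_injective i
  rw [mat_sandwich]
  refine (compl_mul_mul_compl_eq_zero (G := fun s => mat i (γ s)) (fun p q => ?_)
    (hγ.mono fun s hs => le_of_eq hs) hU hV hS ?_).trans rfl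
  · exact (EuclideanSpace.proj (𝕜 := ℝ) ((splitIdx n i).symm (p, q))).hasFDerivAt.comp_hasDerivAt
      0 hγ'
  · simp only [hγ0, mat_ten]

/-- The complementary part of a vector field that is nearly tangential to the rank manifold is
small at `U S Vᵀ`, whether or not `S` is invertible. -/
theorem norm_sandwich_compl_le (hU : Uᵀ * U = 1) (hV : Vᵀ * V = 1) {f : Tensor n → Tensor n}
    (hf : Continuous f) {A : Tensor n} {ρ ε : ℝ}
    (hdec : ∀ Y ∈ rankManifold n i r, ‖Y - A‖ < ρ → ∃ M R : Tensor n, f Y = M + R ∧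
      M ∈ tangentVectors (rankManifold n i r) Y ∧ ‖R‖ ≤ ε)
    (hA : ‖ten i (U * S * Vᵀ) - A‖ < ρ) :
    ‖sandwich i (1 - U * Uᵀ) (1 - V * Vᵀ) (f (ten i (U * S * Vᵀ)))‖ ≤ ε := by
  -- Perturbing only the core keeps `U` and `V`, so the same complementary projections kill the
  -- tangential part for every small `η` with `S + η` invertible; continuity of `f` then gives `η =
  -- 0`.
  have hlin : ∀ η : ℝ, ten i (U * (S + η • (1 : Matrix (Fin r) (Fin r) ℝ)) * Vᵀ) =
      ten i (U * S * Vᵀ) + η • ten i (U * Vᵀ) := by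
    intro η
    rw [Matrix.mul_add, Matrix.add_mul, Matrix.mul_smul, Matrix.smul_mul, Matrix.mul_one]
    rfl
  have hcont : Continuous fun η : ℝ => ten i (U * S * Vᵀ) + η • ten i (U * Vᵀ) := by fun_prop
  have hlim : Filter.Tendsto (fun η : ℝ => ‖sandwich i (1 - U * Uᵀ) (1 - V * Vᵀ)
      (f (ten i (U * S * Vᵀ) + η • ten i (U * Vᵀ)))‖) (𝓝[≠] 0)
      (𝓝 ‖sandwich i (1 - U * Uᵀ) (1 - V * Vᵀ) (f (ten i (U * S * Vᵀ)))‖) := by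
    have h : Continuous fun η : ℝ => ‖sandwich i (1 - U * Uᵀ) (1 - V * Vᵀ)
        (f (ten i (U * S * Vᵀ) + η • ten i (U * Vᵀ)))‖ :=
      ((LinearMap.continuous_of_finiteDimensional _).comp (hf.comp hcont)).norm
    have h0 := (h.tendsto 0).mono_left (nhdsWithin_le_nhds (s := {0}ᶜ))
    simpa using h0
  have hclose : ∀ᶠ η : ℝ in 𝓝[≠] 0, ‖ten i (U * S * Vᵀ) + η • ten i (U * Vᵀ) - A‖ < ρ := by
    refine nhdsWithin_le_nhds ?_
    have h : Continuous fun η : ℝ => ‖ten i (U * S * Vᵀ) + η • ten i (U * Vᵀ) - A‖ := by fun_prop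
    exact (h.tendsto 0).eventually_lt_const (by simpa using hA)
  refine le_of_tendsto hlim ?_
  filter_upwards [hclose, eventually_det_add_smul_one_ne_zero S] with η hη hdet
  rw [← hlin] at hη ⊢
  obtain ⟨M, R, hMR, hM, hR⟩ := hdec _
    (by rw [rankManifold, Set.mem_ofPred_eq, mat_ten,
          rank_mul_mul_transpose_of_det_ne_zero hU hV hdet]) hη
  rw [hMR, map_add, sandwich_compl_tangent_eq_zero hU hV hdet hM, zero_add]
  exact (norm_sandwich_le (transpose_compl U) (compl_mul_compl hU) (transpose_compl V)
    (compl_mul_compl hV) R).trans hR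

end Defect

/-! ### Abstract error analysis of a telescoping splitting. -/

section Splitting

variable {E : Type*} [NormedAddCommGroup E] [NormedSpace ℝ E] {d : ℕ}

/-- The curves `κ i`, `σ i` and `l` perform the substeps of a splitting of `Y' = F(t, Y)` on
`[a, b]` with the operators `p i`, `-q i` and `g`, passing through the states `y`. -/
structure SplittingCurves (F : ℝ → E → E) (a b : ℝ) (p q : Fin d → E →ₗ[ℝ] E) (g : E →ₗ[ℝ] E)
    (κ σ : Fin d → ℝ → E) (l : ℝ → E) (y : Fin (d + 1) → E) : Prop where
  first_left : ∀ i, κ i a = y i.castSucc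
  second_left : ∀ i, σ i a = κ i b
  second_right : ∀ i, σ i b = y i.succ
  last_left : l a = y (Fin.last d)
  first_deriv : ∀ i, ∀ t ∈ Set.Icc a b,
    HasDerivWithinAt (κ i) (p i (F t (κ i t))) (Set.Icc a b) t
  second_deriv : ∀ i, ∀ t ∈ Set.Icc a b,
    HasDerivWithinAt (σ i) (-q i (F t (σ i t))) (Set.Icc a b) t
  last_deriv : ∀ t ∈ Set.Icc a b, HasDerivWithinAt l (g (F t (l t))) (Set.Icc a b) t
  first_contr : ∀ i x, ‖p i x‖ ≤ ‖x‖
  second_contr : ∀ i x, ‖q i x‖ ≤ ‖x‖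
  last_contr : ∀ x, ‖g x‖ ≤ ‖x‖

theorem norm_sub_left_le {f f' : ℝ → E} {a b B : ℝ} (hB : 0 ≤ B)
    (hf : ∀ t ∈ Set.Icc a b, HasDerivWithinAt f (f' t) (Set.Icc a b) t)
    (hf' : ∀ t ∈ Set.Icc a b, ‖f' t‖ ≤ B) {t : ℝ} (ht : t ∈ Set.Icc a b) :
    ‖f t - f a‖ ≤ B * (b - a) :=
  (norm_image_sub_le_of_norm_deriv_le_segment' hf
    (fun x hx => hf' x (Set.Ico_subset_Icc_self hx)) t ht).trans
    (mul_le_mul_of_nonneg_left (sub_le_sub_right ht.2 a) hB)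

namespace SplittingCurves

variable {F : ℝ → E → E} {a b B L ε : ℝ} {p q N : Fin d → E →ₗ[ℝ] E} {g : E →ₗ[ℝ] E}
  {κ σ : Fin d → ℝ → E} {l : ℝ → E} {y : Fin (d + 1) → E}

theorem norm_first_sub_le (h : SplittingCurves F a b p q g κ σ l y) (hB : 0 ≤ B)
    (hF : ∀ t ∈ Set.Icc a b, ∀ x, ‖F t x‖ ≤ B) (i : Fin d) {t : ℝ} (ht : t ∈ Set.Icc a b) :
    ‖κ i t - y i.castSucc‖ ≤ B * (b - a) := by
  rw [← h.first_left]
  exact norm_sub_left_le hB (h.first_deriv i)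
    (fun t ht => (h.first_contr i _).trans (hF t ht _)) ht

theorem norm_second_sub_le (h : SplittingCurves F a b p q g κ σ l y) (hB : 0 ≤ B)
    (hF : ∀ t ∈ Set.Icc a b, ∀ x, ‖F t x‖ ≤ B) (i : Fin d) {t : ℝ} (ht : t ∈ Set.Icc a b) :
    ‖σ i t - y i.castSucc‖ ≤ 2 * (B * (b - a)) := by
  have h₁ := h.norm_first_sub_le hB hF i (Set.right_mem_Icc.mpr (ht.1.trans ht.2))
  have h₂ : ‖σ i t - κ i b‖ ≤ B * (b - a) := by
    rw [← h.second_left]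
    refine norm_sub_left_le hB (h.second_deriv i) (fun t ht => ?_) ht
    rw [norm_neg]
    exact (h.second_contr i _).trans (hF t ht _)
  linarith [norm_sub_le_norm_sub_add_norm_sub (σ i t) (κ i b) (y i.castSucc)]

theorem norm_state_sub_le (h : SplittingCurves F a b p q g κ σ l y) (hab : a ≤ b) (hB : 0 ≤ B)
    (hF : ∀ t ∈ Set.Icc a b, ∀ x, ‖F t x‖ ≤ B) (j : Fin (d + 1)) :
    ‖y j - y 0‖ ≤ 2 * j * (B * (b - a)) := by
  induction j using Fin.induction with
  | zero => simp
  | succ i ih =>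
    have h₁ := h.norm_second_sub_le hB hF i (Set.right_mem_Icc.mpr hab)
    rw [h.second_right] at h₁
    have h₂ := norm_sub_le_norm_sub_add_norm_sub (y i.succ) (y i.castSucc) (y 0)
    rw [Fin.val_succ]
    rw [Fin.val_castSucc] at ih
    push_cast
    linarith

theorem norm_first_sub_zero_le (h : SplittingCurves F a b p q g κ σ l y) (hB : 0 ≤ B)
    (hF : ∀ t ∈ Set.Icc a b, ∀ x, ‖F t x‖ ≤ B) (i : Fin d) {t : ℝ} (ht : t ∈ Set.Icc a b) :
    ‖κ i t - y 0‖ ≤ (2 * d + 1) * (B * (b - a)) := by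
  have hab := ht.1.trans ht.2
  have h₁ := h.norm_first_sub_le hB hF i ht
  have h₂ := h.norm_state_sub_le hab hB hF i.castSucc
  rw [Fin.val_castSucc] at h₂
  have hi : ((i : ℕ) : ℝ) ≤ d := by exact_mod_cast i.2.le
  have hBh : 0 ≤ B * (b - a) := mul_nonneg hB (sub_nonneg.mpr hab)
  linarith [norm_sub_le_norm_sub_add_norm_sub (κ i t) (y i.castSucc) (y 0),
    mul_le_mul_of_nonneg_right hi hBh]

theorem norm_second_sub_zero_le (h : SplittingCurves F a b p q g κ σ l y) (hB : 0 ≤ B)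
    (hF : ∀ t ∈ Set.Icc a b, ∀ x, ‖F t x‖ ≤ B) (i : Fin d) {t : ℝ} (ht : t ∈ Set.Icc a b) :
    ‖σ i t - y 0‖ ≤ (2 * d + 1) * (B * (b - a)) := by
  have hab := ht.1.trans ht.2
  have h₁ := h.norm_second_sub_le hB hF i ht
  have h₂ := h.norm_state_sub_le hab hB hF i.castSucc
  rw [Fin.val_castSucc] at h₂
  have hi : ((i : ℕ) : ℝ) + 1 ≤ d := by exact_mod_cast i.2
  have hBh : 0 ≤ B * (b - a) := mul_nonneg hB (sub_nonneg.mpr hab)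
  linarith [norm_sub_le_norm_sub_add_norm_sub (σ i t) (y i.castSucc) (y 0),
    mul_le_mul_of_nonneg_right hi hBh]

theorem norm_last_sub_zero_le (h : SplittingCurves F a b p q g κ σ l y) (hB : 0 ≤ B)
    (hF : ∀ t ∈ Set.Icc a b, ∀ x, ‖F t x‖ ≤ B) {t : ℝ} (ht : t ∈ Set.Icc a b) :
    ‖l t - y 0‖ ≤ (2 * d + 1) * (B * (b - a)) := by
  have h₁ : ‖l t - y (Fin.last d)‖ ≤ B * (b - a) := by
    rw [← h.last_left]
    exact norm_sub_left_le hB h.last_deriv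
      (fun t ht => (h.last_contr _).trans (hF t ht _)) ht
  have h₂ := h.norm_state_sub_le (ht.1.trans ht.2) hB hF (Fin.last d)
  rw [Fin.val_last] at h₂
  linarith [norm_sub_le_norm_sub_add_norm_sub (l t) (y (Fin.last d)) (y 0)]

/-- All substeps run over the same interval `[a, b]`, so they can be added as functions of one time;
the sum has the increment of the whole step. -/
theorem sum_increments (h : SplittingCurves F a b p q g κ σ l y) :
    (∑ i, (κ i b + σ i b) + l b) - (∑ i, (κ i a + σ i a) + l a) = l b - y 0 := by
  have h₁ : ∑ i, (κ i b + σ i b) - ∑ i, (κ i a + σ i a) = y (Fin.last d) - y 0 := by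
    have htel : ∑ i : Fin d, (y i.succ - y i.castSucc) = y (Fin.last d) - y 0 := by
      rw [Finset.sum_sub_distrib, sub_eq_sub_iff_add_eq_add, add_comm,
        add_comm (y (Fin.last d))]
      exact (Fin.sum_univ_succ y).symm.trans (Fin.sum_univ_castSucc y)
    rw [← Finset.sum_sub_distrib, ← htel]
    refine Finset.sum_congr rfl fun i _ => ?_
    rw [h.second_left, h.first_left, h.second_right]
    abel
  rw [add_sub_add_comm, h₁, h.last_left]
  abel

/-- Error recursion for one step of a splitting whose operators telescope up to the operators
`N i`, provided that `N i` nearly annihilates the vector field after the first substep of each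
pair of substeps. -/
theorem norm_sub_le (h : SplittingCurves F a b p q g κ σ l y) (hab : a ≤ b) (hB : 0 ≤ B)
    (hL : 0 ≤ L) (hF : ∀ t ∈ Set.Icc a b, ∀ x, ‖F t x‖ ≤ B)
    (hLip : ∀ t ∈ Set.Icc a b, ∀ x x', ‖F t x - F t x'‖ ≤ L * ‖x - x'‖) {A : ℝ → E}
    (hA : ∀ t ∈ Set.Icc a b, HasDerivWithinAt A (F t (A t)) (Set.Icc a b) t)
    (hN : ∀ i x, ‖N i x‖ ≤ ‖x‖) {G : ℕ → E →ₗ[ℝ] E} (hG0 : ∀ x, G 0 x = x) (hGd : G d = g)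
    (hres : ∀ (i : Fin d) (x), ‖p i x - q i x - (G i x - G (i + 1) x)‖ ≤ ‖N i x‖)
    (hdef : ∀ i, ∀ t ∈ Set.Icc a b, ‖N i (F t (κ i b))‖ ≤ ε) :
    ‖l b - A b‖ ≤ ‖y 0 - A a‖ + (b - a) * (d * ε + L * ‖y 0 - A a‖ +
      (3 * d + 2) * (L * ((2 * d + 1) * (B * (b - a))))) := by
  -- `D` bounds the distance from `y 0` to every point reached: at most `2 d` substeps in the modes
  -- and the last one, each of length at most `B (b - a)`.
  set D : ℝ := (2 * d + 1) * (B * (b - a)) with hD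
  have hBh : 0 ≤ B * (b - a) := mul_nonneg hB (sub_nonneg.mpr hab)
  have hBD : B * (b - a) ≤ D := by
    rw [hD]
    nlinarith [mul_nonneg (Nat.cast_nonneg (α := ℝ) d) hBh]
  have hderiv : ∀ t ∈ Set.Icc a b, HasDerivWithinAt
      (fun t => ∑ i, (κ i t + σ i t) + l t - A t)
      (∑ i, (p i (F t (κ i t)) + -q i (F t (σ i t))) + g (F t (l t)) - F t (A t))
      (Set.Icc a b) t := fun t ht =>
    ((HasDerivWithinAt.fun_sum fun i _ => (h.first_deriv i t ht).add (h.second_deriv i t ht)).add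
      (h.last_deriv t ht)).sub (hA t ht)
  have hbound : ∀ t ∈ Set.Icc a b,
      ‖∑ i, (p i (F t (κ i t)) + -q i (F t (σ i t))) + g (F t (l t)) - F t (A t)‖ ≤
        d * ε + L * ‖y 0 - A a‖ + (3 * d + 2) * (L * D) := by
    intro t ht
    -- Freezing the field at `y 0` lets the operators telescope on one common vector.
    set f := F t (y 0)
    have hclose : ∀ x, ‖x - y 0‖ ≤ D → ‖F t x - f‖ ≤ L * D := fun x hx =>
      (hLip t ht x (y 0)).trans (mul_le_mul_of_nonneg_left hx hL)
    have htel : ∑ i : Fin d, (G i f - G (i + 1) f) = f - g f := by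
      rw [Fin.sum_univ_eq_sum_range (fun i => G i f - G (i + 1) f) d,
        Finset.sum_range_sub' (fun i => G i f), hG0, hGd]
    have hsplit : ∑ i, (p i (F t (κ i t)) + -q i (F t (σ i t))) + g (F t (l t)) - F t (A t) =
        ∑ i, (p i (F t (κ i t) - f) - q i (F t (σ i t) - f) +
          (p i f - q i f - (G i f - G (i + 1) f))) +
        (g (F t (l t) - f) - (F t (A t) - f)) := by
      have : ∀ i : Fin d, p i (F t (κ i t) - f) - q i (F t (σ i t) - f) +
          (p i f - q i f - (G i f - G (i + 1) f)) =
          p i (F t (κ i t)) + -q i (F t (σ i t)) - (G i f - G (i + 1) f) := by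
        intro i
        rw [map_sub, map_sub]
        abel
      rw [Finset.sum_congr rfl fun i _ => this i, Finset.sum_sub_distrib, htel, map_sub]
      abel
    -- Three errors of freezing per mode: in `p i`, in `q i`, and in moving the defect from `κ i b`
    -- to `y 0`. With one each for `g` and `A` they make up `3 d + 2`.
    have hterm : ∀ i : Fin d, ‖p i (F t (κ i t) - f) - q i (F t (σ i t) - f) +
        (p i f - q i f - (G i f - G (i + 1) f))‖ ≤ ε + 3 * (L * D) := by
      intro i
      have h₁ := (h.first_contr i _).trans (hclose _ (h.norm_first_sub_zero_le hB hF i ht))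
      have h₂ := (h.second_contr i _).trans (hclose _ (h.norm_second_sub_zero_le hB hF i ht))
      have h₃ : ‖N i f‖ ≤ ε + L * D := by
        have hb := hclose _ (h.norm_first_sub_zero_le hB hF i (Set.right_mem_Icc.mpr hab))
        have : N i f = N i (F t (κ i b)) - N i (F t (κ i b) - f) := by rw [map_sub]; abel
        rw [this]
        exact (_root_.norm_sub_le _ _).trans (add_le_add (hdef i t ht) ((hN i _).trans hb))
      linarith [norm_add_le (p i (F t (κ i t) - f) - q i (F t (σ i t) - f))
        (p i f - q i f - (G i f - G (i + 1) f)), hres i f,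
        _root_.norm_sub_le (p i (F t (κ i t) - f)) (q i (F t (σ i t) - f))]
    have hlast := (h.last_contr _).trans (hclose _ (h.norm_last_sub_zero_le hB hF ht))
    have hAt : ‖F t (A t) - f‖ ≤ L * (‖y 0 - A a‖ + D) := by
      refine (hLip t ht _ _).trans (mul_le_mul_of_nonneg_left ?_ hL)
      have := norm_sub_left_le hB hA (fun t ht => hF t ht _) ht
      have h' := norm_sub_le_norm_sub_add_norm_sub (A t) (A a) (y 0)
      rw [norm_sub_rev (A a)] at h'
      linarith
    have hsum := norm_sum_le_of_le Finset.univ fun i _ => hterm i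
    rw [Finset.sum_const, Finset.card_univ, Fintype.card_fin, nsmul_eq_mul] at hsum
    rw [hsplit]
    refine (norm_add_le _ _).trans ?_
    linarith [_root_.norm_sub_le (g (F t (l t) - f)) (F t (A t) - f)]
  have hmv := norm_image_sub_le_of_norm_deriv_le_segment' hderiv
    (fun t ht => hbound t (Set.Ico_subset_Icc_self ht)) b (Set.right_mem_Icc.mpr hab)
  have hΦ : ∑ i, (κ i b + σ i b) + l b - A b - (∑ i, (κ i a + σ i a) + l a - A a) =
      (l b - A b) - (y 0 - A a) := by
    have := h.sum_increments
    rw [sub_sub_sub_comm, this]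
    abel
  rw [hΦ] at hmv
  have := norm_sub_norm_le (l b - A b) (y 0 - A a)
  linarith

end SplittingCurves

/-- The recursion is available only while the error stays below `M`, that is, while the numerical
solution stays near `A`; the induction carries this along with the bound. -/
theorem le_mul_exp_of_recursion {e : ℕ → ℝ} {L h c M : ℝ} {N : ℕ} (hL : 0 ≤ L) (hh : 0 ≤ h)
    (hc : 0 ≤ c) (h0 : e 0 ≤ 0) (hM : N * h * Real.exp (L * (N * h)) * c ≤ M)
    (hstep : ∀ m < N, e m ≤ M → e (m + 1) ≤ e m + h * (c + L * e m)) : e N ≤ M := by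
  have key : ∀ m ≤ N, e m ≤ m * h * Real.exp (L * (m * h)) * c := by
    intro m
    induction m with
    | zero => intro _; simpa using h0
    | succ m ih =>
      intro hm
      have him := ih (Nat.le_of_succ_le hm)
      have hmN : (m : ℝ) * h ≤ N * h :=
        mul_le_mul_of_nonneg_right (by exact_mod_cast Nat.le_of_succ_le hm) hh
      have hle : (m : ℝ) * h * Real.exp (L * (m * h)) * c ≤ M := by
        refine le_trans ?_ hM
        gcongr
      have hs := hstep m hm (him.trans hle)
      have hexp : Real.exp (L * ((m + 1 : ℕ) * h)) = Real.exp (L * (m * h)) * Real.exp (L * h) := by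
        rw [← Real.exp_add]
        congr 1
        push_cast
        ring
      have h₁ : 1 + L * h ≤ Real.exp (L * h) := by linarith [Real.add_one_le_exp (L * h)]
      have h₂ : 1 ≤ Real.exp (L * ((m + 1 : ℕ) * h)) := Real.one_le_exp (by positivity)
      calc e (m + 1) ≤ (1 + L * h) * e m + h * c := by linarith
        _ ≤ Real.exp (L * h) * (m * h * Real.exp (L * (m * h)) * c) + h * c * 1 := by
          rw [mul_one]
          refine add_le_add ?_ le_rfl
          exact (mul_le_mul_of_nonneg_left him (by positivity)).trans
            (mul_le_mul_of_nonneg_right h₁ (by positivity))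
        _ ≤ Real.exp (L * h) * (m * h * Real.exp (L * (m * h)) * c) +
            h * c * Real.exp (L * ((m + 1 : ℕ) * h)) := by gcongr
        _ = _ := by rw [hexp]; push_cast; ring
  exact (key N le_rfl).trans hM

end Splitting

/-! ### The nested Tucker integrator as a splitting. -/

section Integrator

variable {d : ℕ} {n r : Fin d → ℕ} {F : ℝ → Tensor n → Tensor n} {a b : ℝ}

theorem SolvesMatrixODE.hasDerivWithinAt_ten {i : Fin d} {ι κ : Type} [Fintype ι] [Fintype κ]
    {G : ℝ → Matrix ι κ ℝ → Matrix ι κ ℝ} {X : ℝ → Matrix ι κ ℝ} (h : SolvesMatrixODE G a b X)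
    (P : Matrix (Fin (n i)) ι ℝ) (R : Matrix κ (LowIdx n i × UpIdx n i) ℝ) {t : ℝ}
    (ht : t ∈ Set.Icc a b) :
    HasDerivWithinAt (fun t => ten i (P * X t * R)) (ten i (P * G t (X t) * R))
      (Set.Icc a b) t := by
  rw [hasDerivWithinAt_iff_hasFDerivWithinAt, hasFDerivWithinAt_euclidean]
  intro x
  rw [hasFDerivWithinAt_iff_hasDerivWithinAt]
  have : HasDerivWithinAt (fun t => (P * X t * R) (splitIdx n i x).1 (splitIdx n i x).2)
      ((P * G t (X t) * R) (splitIdx n i x).1 (splitIdx n i x).2) (Set.Icc a b) t := by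
    simp only [Matrix.mul_apply]
    exact HasDerivWithinAt.fun_sum fun q _ =>
      (HasDerivWithinAt.fun_sum fun p _ => (h t ht p q).const_mul _).mul_const _
  simpa [ten] using this

theorem kronLow_congr {U U' : (k : Fin d) → Matrix (Fin (n k)) (Fin (r k)) ℝ} {i : Fin d}
    (h : ∀ k < i, U k = U' k) : kronLow U i = kronLow U' i := by
  rw [kronLow, kronLow]
  congr 1
  funext k
  exact h k k.2

theorem kronUp_congr {U U' : (k : Fin d) → Matrix (Fin (n k)) (Fin (r k)) ℝ} {i : Fin d}
    (h : ∀ k, i < k → U k = U' k) : kronUp U i = kronUp U' i := by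
  rw [kronUp, kronUp]
  congr 1
  funext k
  exact h k k.2

theorem lowBasis_congr {U U' : (k : Fin d) → Matrix (Fin (n k)) (Fin (r k)) ℝ} {i : Fin d}
    (h : ∀ k < i, U k = U' k) : lowBasis U i = lowBasis U' i := by
  rw [lowBasis, lowBasis, kronLow_congr h]

theorem unfoldedField_eq (U : (k : Fin d) → Matrix (Fin (n k)) (Fin (r k)) ℝ) (i : Fin d) (t : ℝ)
    (Y : Matrix (Fin (n i)) (LowIdx r i × UpIdx n i) ℝ) :
    unfoldedField F U i t Y =
      mat i (F t (ten i (Y * (lowBasis U i)ᵀ))) * lowBasis U i := rfl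

theorem kronLow_kron_kronUp (U : (k : Fin d) → Matrix (Fin (n k)) (Fin (r k)) ℝ) (i : Fin d) :
    kronLow U i ⊗ₖ kronUp U i =
      lowBasis U i * ((1 : Matrix (LowIdx r i) (LowIdx r i) ℝ) ⊗ₖ kronUp U i) := by
  rw [lowBasis, ← Matrix.mul_kronecker_mul, Matrix.mul_one, Matrix.one_mul]

theorem TuckerData.toTensor_eq_ten (X : TuckerData n r) (i : Fin d) :
    X.toTensor =
      ten i (X.basis i * mat i X.core * (kronLow X.basis i ⊗ₖ kronUp X.basis i)ᵀ) := by
  rw [← mat_modeMul, ten_mat, X.toTensor_eq_modeMul]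

theorem ModeStep.orthonormal {i : Fin d} {X X' : TuckerData n r} (h : ModeStep F a b i X X')
    (hX : X.Orthonormal) : X'.Orthonormal := by
  obtain ⟨_, _, _, _, _, _, -, -, -, -, hQR, -, -, -, hb⟩ := h
  intro k
  by_cases hk : k = i
  · subst hk
    exact hQR.2.1
  · rw [hb k hk]
    exact hX k

theorem ModeStep.basis_eq {i : Fin d} {X X' : TuckerData n r} (h : ModeStep F a b i X X')
    {k : Fin d} (hk : k ≠ i) : X'.basis k = X.basis k := by
  obtain ⟨_, _, _, _, _, _, -, -, -, -, -, -, -, -, hb⟩ := h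
  exact hb k hk

/-- The K-step and the S-step in mode `i`, lifted to the full tensor space, are driven by the
projected vector fields. -/
theorem ModeStep.exists_curves {i : Fin d} {X X' : TuckerData n r} (h : ModeStep F a b i X X')
    (hX : X.Orthonormal) :
    ∃ (V : Matrix (LowIdx n i × UpIdx n i) (Fin (r i)) ℝ) (S : Matrix (Fin (r i)) (Fin (r i)) ℝ)
      (κ σ : ℝ → Tensor n),
      Vᵀ * V = 1 ∧ lowBasis X.basis i * (lowBasis X.basis i)ᵀ * V = V ∧
      κ a = X.toTensor ∧ κ b = ten i (X'.basis i * S * Vᵀ) ∧ σ a = κ b ∧ σ b = X'.toTensor ∧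
      (∀ t ∈ Set.Icc a b,
        HasDerivWithinAt κ (sandwich i 1 (V * Vᵀ) (F t (κ t))) (Set.Icc a b) t) ∧
      (∀ t ∈ Set.Icc a b, HasDerivWithinAt σ
        (-sandwich i (X'.basis i * (X'.basis i)ᵀ) (V * Vᵀ) (F t (σ t))) (Set.Icc a b) t) := by
  obtain ⟨Q, S₀, Shat, K, S, V₀, ⟨hQ, hQQ, -⟩, hV₀, hKa, hK, ⟨hKb, -, -⟩, hSa, hS, hcore, hb⟩ := h
  set W := lowBasis X.basis i with hW
  set Z := (1 : Matrix (LowIdx r i) (LowIdx r i) ℝ) ⊗ₖ kronUp X.basis i with hZ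
  have hWW : Wᵀ * W = 1 := transpose_mul_lowBasis hX i
  have hZZ : Zᵀ * Z = 1 := by
    rw [hZ, ← Matrix.kroneckerMap_transpose, ← Matrix.mul_kronecker_mul, transpose_mul_kronUp hX,
      Matrix.transpose_one, Matrix.one_mul, Matrix.one_kronecker_one]
  have hV : V₀ = Z * Q := by
    rw [← Matrix.transpose_transpose V₀, hV₀, Matrix.transpose_mul, Matrix.transpose_transpose,
      Matrix.transpose_transpose]
  have hmat : mat i X.core = S₀ * Qᵀ := by
    rw [← Matrix.transpose_transpose (mat i X.core), hQ, Matrix.transpose_mul,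
      Matrix.transpose_transpose]
  have hkron : kronLow X.basis i ⊗ₖ kronUp X.basis i = W * Z := kronLow_kron_kronUp _ i
  have hkron' : kronLow X'.basis i ⊗ₖ kronUp X'.basis i = W * Z := by
    rw [kronLow_congr fun k hk => hb k hk.ne, kronUp_congr fun k hk => hb k hk.ne', hkron]
  have hWV : (W * V₀)ᵀ = V₀ᵀ * Wᵀ := Matrix.transpose_mul _ _
  -- `W` embeds the reduced columns isometrically into the full ones, so `W * V₀` is the lifted row
  -- basis. The new column basis appears at the end of the K-step through its QR factorization.
  refine ⟨W * V₀, Shat, fun t => ten i ((1 : Matrix (Fin (n i)) (Fin (n i)) ℝ) * K t * (W * V₀)ᵀ),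
    fun t => ten i (X'.basis i * S t * (W * V₀)ᵀ), ?_, ?_, ?_, ?_, ?_, ?_, ?_, ?_⟩
  · calc (W * V₀)ᵀ * (W * V₀) = V₀ᵀ * (Wᵀ * W) * V₀ := by
          rw [hWV]; simp only [Matrix.mul_assoc]
      _ = Qᵀ * (Zᵀ * Z) * Q := by
          rw [hWW, Matrix.mul_one, hV, Matrix.transpose_mul]; simp only [Matrix.mul_assoc]
      _ = 1 := by rw [hZZ, Matrix.mul_one, hQQ]
  · calc W * Wᵀ * (W * V₀) = W * (Wᵀ * W) * V₀ := by simp only [Matrix.mul_assoc]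
      _ = W * V₀ := by rw [hWW, Matrix.mul_one]
  · rw [X.toTensor_eq_ten i, hkron, hmat]
    simp only [hKa, hV, Matrix.one_mul, Matrix.transpose_mul, Matrix.mul_assoc]
  · simp only [hKb, Matrix.one_mul]
  · simp only [hSa, hKb, Matrix.one_mul]
  · rw [X'.toTensor_eq_ten i, hkron', hcore, mat_ten]
    simp only [hV, Matrix.transpose_mul, Matrix.mul_assoc]
  · intro t ht
    refine (hK.hasDerivWithinAt_ten 1 (W * V₀)ᵀ ht).congr_deriv ?_
    apply mat_injective i
    simp only [mat_sandwich, mat_ten, unfoldedField_eq, ← hW, hWV, Matrix.one_mul,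
      Matrix.mul_assoc]
  · intro t ht
    refine (hS.hasDerivWithinAt_ten (X'.basis i) (W * V₀)ᵀ ht).congr_deriv ?_
    rw [Matrix.mul_neg, Matrix.neg_mul]
    change -ten i _ = _
    congr 1
    apply mat_injective i
    simp only [mat_sandwich, mat_ten, unfoldedField_eq, ← hW, hWV, Matrix.mul_assoc]

theorem lowProj_last (U : (k : Fin d) → Matrix (Fin (n k)) (Fin (r k)) ℝ) (Y : Tensor n) :
    lowProj U d Y = modeMul U (modeMul (fun k => (U k)ᵀ) Y) := by
  rw [modeMul_modeMul, lowProj]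
  simp only [Fin.is_lt, if_true]

theorem norm_lowProj_le {U : (k : Fin d) → Matrix (Fin (n k)) (Fin (r k)) ℝ}
    (hU : ∀ k, (U k)ᵀ * U k = 1) (j : Fin (d + 1)) (Y : Tensor n) : ‖lowProj U j Y‖ ≤ ‖Y‖ := by
  induction j using Fin.cases with
  | zero => exact (congrArg norm (lowProj_zero U Y)).le
  | succ i =>
    rw [Fin.val_succ, lowProj_succ]
    exact norm_sandwich_le (transpose_proj _) (proj_mul_proj (hU i)) (transpose_proj _)
      (proj_mul_proj (transpose_mul_lowBasis hU i)) Y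

theorem FinalStep.basis_eq {X X' : TuckerData n r} (h : FinalStep F a b X X') :
    X'.basis = X.basis := by
  obtain ⟨_, _, -, -, -, -, hb⟩ := h
  exact hb

theorem FinalStep.exists_curve {X X' : TuckerData n r} (h : FinalStep F a b X X') :
    ∃ l : ℝ → Tensor n, l a = X.toTensor ∧ l b = X'.toTensor ∧
      ∀ t ∈ Set.Icc a b, HasDerivWithinAt l (lowProj X.basis d (F t (l t))) (Set.Icc a b) t := by
  obtain ⟨i, LT, -, hLa, hL, hcore, hb⟩ := h
  set Z := kronLow X.basis i ⊗ₖ kronUp X.basis i with hZ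
  refine ⟨fun t => ten i (X.basis i * LT t * Zᵀ), ?_, ?_, fun t ht => ?_⟩
  · rw [X.toTensor_eq_ten i, ← hLa]
  · rw [X'.toTensor_eq_ten i, hb, hcore, mat_ten]
  · refine (hL.hasDerivWithinAt_ten (X.basis i) Zᵀ ht).congr_deriv ?_
    apply mat_injective i
    rw [lowProj_last, mat_modeMul, mat_modeMul, mat_ten]
    have : (kronLow (fun k => (X.basis k)ᵀ) i ⊗ₖ kronUp (fun k => (X.basis k)ᵀ) i)ᵀ = Z := by
      rw [← Matrix.kroneckerMap_transpose]
      rfl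
    rw [this, ← hZ]
    simp only [Matrix.mul_assoc]

/-- The operators of the substeps in mode `i` telescope up to the product of the complementary
projections. -/
theorem norm_mode_residual_le {U : (k : Fin d) → Matrix (Fin (n k)) (Fin (r k)) ℝ}
    (hU : ∀ k, (U k)ᵀ * U k = 1) (i : Fin d)
    {V : Matrix (LowIdx n i × UpIdx n i) (Fin (r i)) ℝ}
    (hV : lowBasis U i * (lowBasis U i)ᵀ * V = V) (Y : Tensor n) :
    ‖sandwich i 1 (V * Vᵀ) Y - sandwich i (U i * (U i)ᵀ) (V * Vᵀ) Y -
      (lowProj U i Y - lowProj U (i + 1) Y)‖ ≤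
      ‖sandwich i (1 - U i * (U i)ᵀ) (1 - V * Vᵀ) Y‖ := by
  rw [lowProj_castSucc, lowProj_succ]
  set W := lowBasis U i * (lowBasis U i)ᵀ with hW
  have hVW : V * Vᵀ * W = V * Vᵀ := by
    have : Vᵀ * W = Vᵀ := by
      have hWt : Wᵀ = W := transpose_proj _
      rw [← hWt, ← Matrix.transpose_mul, hV]
    rw [Matrix.mul_assoc, this]
  -- With `V Vᵀ W = V Vᵀ`, one has `V Vᵀ - W = -(1 - V Vᵀ) W`; the remaining factor `W` is a
  -- contraction.
  have heq : sandwich i 1 (V * Vᵀ) Y - sandwich i (U i * (U i)ᵀ) (V * Vᵀ) Y -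
      (sandwich i 1 W Y - sandwich i (U i * (U i)ᵀ) W Y) =
      -sandwich i 1 W (sandwich i (1 - U i * (U i)ᵀ) (1 - V * Vᵀ) Y) := by
    rw [sandwich_sandwich, Matrix.sub_mul, hVW, Matrix.one_mul, Matrix.one_mul]
    change (matEquiv n i).symm _ - (matEquiv n i).symm _ -
      ((matEquiv n i).symm _ - (matEquiv n i).symm _) = -(matEquiv n i).symm _
    rw [← map_sub, ← map_sub, ← map_sub, ← map_neg]
    congr 1
    simp only [Matrix.sub_mul, Matrix.mul_sub]
    abel
  rw [heq, norm_neg]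
  exact norm_sandwich_le Matrix.transpose_one (Matrix.one_mul 1) (transpose_proj _)
    (proj_mul_proj (transpose_mul_lowBasis hU i)) _

theorem NestedTuckerStep.orthonormal {X X' : TuckerData n r} (h : NestedTuckerStep F a b X X')
    (hX : X.Orthonormal) : X'.Orthonormal := by
  obtain ⟨Z, hZ0, hZ, hfin⟩ := h
  have : ∀ j, (Z j).Orthonormal := fun j => by
    induction j using Fin.induction with
    | zero => rwa [hZ0]
    | succ i ih => exact (hZ i).orthonormal ih
  intro k
  rw [hfin.basis_eq]
  exact this _ k

/-- Error recursion of the nested Tucker integrator. -/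
theorem NestedTuckerStep.norm_sub_le {X X' : TuckerData n r} (h : NestedTuckerStep F a b X X')
    (hX : X.Orthonormal) (hab : a ≤ b) {L B ε ρ : ℝ} {A : ℝ → Tensor n} (hB : 0 ≤ B) (hL : 0 ≤ L)
    (hF : ∀ t ∈ Set.Icc a b, ∀ Y, ‖F t Y‖ ≤ B)
    (hLip : ∀ t ∈ Set.Icc a b, ∀ Y Y', ‖F t Y - F t Y'‖ ≤ L * ‖Y - Y'‖)
    (hA : ∀ t ∈ Set.Icc a b, HasDerivWithinAt A (F t (A t)) (Set.Icc a b) t)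
    (hdec : ∀ i : Fin d, ∀ t ∈ Set.Icc a b, ∀ Y ∈ rankManifold n i (r i), ‖Y - A t‖ < ρ →
      ∃ M R : Tensor n, F t Y = M + R ∧ M ∈ tangentVectors (rankManifold n i (r i)) Y ∧ ‖R‖ ≤ ε)
    (hclose : ‖X.toTensor - A a‖ + (2 * d + 2) * (B * (b - a)) < ρ) :
    ‖X'.toTensor - A b‖ ≤ ‖X.toTensor - A a‖ + (b - a) * (d * ε + L * ‖X.toTensor - A a‖ +
      (3 * d + 2) * (L * ((2 * d + 1) * (B * (b - a))))) := by
  obtain ⟨Z, hZ0, hZ, hfin⟩ := h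
  have horth : ∀ j, (Z j).Orthonormal := fun j => by
    induction j using Fin.induction with
    | zero => rwa [hZ0]
    | succ i ih => exact (hZ i).orthonormal ih
  set U := (Z (Fin.last d)).basis with hUdef
  have hU : ∀ k, (U k)ᵀ * U k = 1 := horth _
  -- Once mode `k` is treated its basis stays fixed, so one family `U` serves all modes and the
  -- `G_j` really telescope.
  have hbasis : ∀ j : Fin (d + 1), ∀ k : Fin d, k.castSucc < j → (Z j).basis k = U k := by
    intro j
    induction j using Fin.reverseInduction with
    | last => intro k _; rfl
    | cast i ih =>
      intro k hk
      rw [← ih k (hk.trans i.castSucc_lt_succ)]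
      exact ((hZ i).basis_eq (Fin.castSucc_lt_castSucc_iff.mp hk).ne).symm
  have hUi : ∀ i : Fin d, (Z i.succ).basis i = U i := fun i => hbasis _ i i.castSucc_lt_succ
  have hlow : ∀ i : Fin d, lowBasis (Z i.castSucc).basis i = lowBasis U i := fun i =>
    lowBasis_congr fun k hk => hbasis _ k (Fin.castSucc_lt_castSucc_iff.mpr hk)
  choose V S κ σ hVV hWV hκa hκb hσa hσb hκ hσ using
    fun i : Fin d => (hZ i).exists_curves (horth i.castSucc)
  simp only [hUi, hlow] at hWV hκb hσ
  obtain ⟨l, hla, hlb, hl⟩ := hfin.exists_curve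
  have hcurves : SplittingCurves F a b (fun i => sandwich i 1 (V i * (V i)ᵀ))
      (fun i => sandwich i (U i * (U i)ᵀ) (V i * (V i)ᵀ)) (lowProj U d) κ σ l
      (fun j => (Z j).toTensor) :=
    { first_left := hκa
      second_left := hσa
      second_right := hσb
      last_left := hla
      first_deriv := hκ
      second_deriv := hσ
      last_deriv := hl
      first_contr := fun i => norm_sandwich_le Matrix.transpose_one (Matrix.one_mul 1)
        (transpose_proj _) (proj_mul_proj (hVV i))
      second_contr := fun i => norm_sandwich_le (transpose_proj _) (proj_mul_proj (hU i))
        (transpose_proj _) (proj_mul_proj (hVV i))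
      last_contr := norm_lowProj_le hU (Fin.last d) }
  have hmain := hcurves.norm_sub_le (ε := ε) (G := lowProj U)
    (N := fun i => sandwich i (1 - U i * (U i)ᵀ) (1 - V i * (V i)ᵀ)) hab hB hL hF hLip hA
    (fun i => norm_sandwich_le (transpose_compl _) (compl_mul_compl (hU i)) (transpose_compl _)
      (compl_mul_compl (hVV i)))
    (lowProj_zero U) rfl (fun i => norm_mode_residual_le hU i (hWV i)) (fun i t ht => by
      rw [hκb i]
      have hcont : Continuous (F t) :=
        (LipschitzWith.of_dist_le_mul (K := ⟨L, hL⟩) fun Y Y' => by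
          rw [dist_eq_norm, dist_eq_norm]
          exact hLip t ht Y Y').continuous
      refine norm_sandwich_compl_le (hU i) (hVV i) hcont (hdec i t ht) ?_
      rw [← hκb i]
      -- The numerical path contributes `2 d + 1` lengths `B (b - a)` and the exact solution one
      -- more, which gives the `2 d + 2` in `hclose`.
      have h₁ := hcurves.norm_first_sub_zero_le hB hF i (Set.right_mem_Icc.mpr hab)
      have h₂ := norm_sub_left_le hB hA (fun t ht => hF t ht _) ht
      simp only [hZ0] at h₁
      have h₃ := norm_sub_le_norm_sub_add_norm_sub (κ i b) X.toTensor (A t)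
      have h₄ := norm_sub_le_norm_sub_add_norm_sub X.toTensor (A a) (A t)
      rw [norm_sub_rev (A a)] at h₄
      linarith)
  rwa [hlb, hZ0] at hmain

end Integrator
end

/-! ### The global error bound. -/

theorem IsNestedTuckerRun.orthonormal {d : ℕ} {n r : Fin d → ℕ} {F : ℝ → Tensor n → Tensor n}
    {t₀ h : ℝ} {Y₀ : Tensor n} {N : ℕ} {Y : ℕ → TuckerData n r}
    (hY : IsNestedTuckerRun F t₀ h Y₀ N Y) {m : ℕ} (hm : m ≤ N) : (Y m).Orthonormal := by
  induction m with
  | zero => exact hY.1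
  | succ m ih => exact (hY.2.2 m hm).orthonormal (ih (Nat.le_of_succ_le hm))

theorem mainTheorem2 (d : ℕ) (hd : 0 < d) (L B τ : ℝ) :
    ∃ c₁ c₂ : ℝ, 0 < c₁ ∧ 0 < c₂ ∧
      ∀ (n r : Fin d → ℕ) (F : ℝ → Tensor n → Tensor n) (A : ℝ → Tensor n) (t₀ T ε ρ : ℝ),
        T - t₀ = τ → 0 ≤ ε → 0 < ρ →
        -- `A` solves the tensor differential equation on `[t₀, T]`
        (∀ t ∈ Set.Icc t₀ T, HasDerivWithinAt A (F t (A t)) (Set.Icc t₀ T) t) →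
        -- `F` is Lipschitz continuous and bounded
        (∀ t ∈ Set.Icc t₀ T, ∀ Y Y' : Tensor n, ‖F t Y - F t Y'‖ ≤ L * ‖Y - Y'‖) →
        (∀ t ∈ Set.Icc t₀ T, ∀ Y : Tensor n, ‖F t Y‖ ≤ B) →
        -- decomposition into a tangential part and a small perturbation, for each mode
        (∀ i : Fin d, ∀ t ∈ Set.Icc t₀ T, ∀ Y ∈ rankManifold n i (r i), ‖Y - A t‖ < ρ →
          ∃ M R : Tensor n, F t Y = M + R ∧
            M ∈ tangentVectors (rankManifold n i (r i)) Y ∧ ‖R‖ ≤ ε) →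
        -- the initial value has multilinear rank `r`
        HasMultilinearRank r (A t₀) →
        ∀ (h : ℝ) (N : ℕ) (Y : ℕ → TuckerData n r), 0 < h → t₀ + N * h ≤ T →
          c₁ * h + c₂ * ε ≤ ρ →
          IsNestedTuckerRun F t₀ h (A t₀) N Y →
          ‖(Y N).toTensor - A (t₀ + N * h)‖ ≤ c₁ * h + c₂ * ε := by
  set E := |τ| * Real.exp (|L| * |τ|) with hE
  set c := (3 * (d : ℝ) + 2) * (|L| * ((2 * d + 1) * |B|)) with hc
  have hc0 : 0 ≤ c := by positivity
  have hE0 : 0 ≤ E := by positivity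
  -- The terms with `E` come from the recursion, and absolute values appear because no signs of `L`,
  -- `B`, `τ` are given. The term `(2 * d + 2) * |B|` pays for the excursion within one step, so
  -- that all substeps stay within `ρ` of `A`; the summands `1` give positivity and, with `0 < h`,
  -- the strict inequality `hnum`.
  refine ⟨E * c + (2 * d + 2) * |B| + 1, E * d + 1, by positivity, by positivity, ?_⟩
  intro n r F A t₀ T ε ρ hτ hε _ hA hLip hF hdec _ h N Y hh hNT hρ hY
  have hNh : N * h ≤ |τ| := by linarith [le_abs_self τ]
  have hnum : E * (d * ε + c * h) + (2 * d + 2) * (|B| * h) < ρ := by nlinarith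
  have hgoal : ‖(Y N).toTensor - A (t₀ + N * h)‖ ≤ E * (d * ε + c * h) := by
    refine le_mul_exp_of_recursion (e := fun m => ‖(Y m).toTensor - A (t₀ + m * h)‖)
      (c := d * ε + c * h) (abs_nonneg L) hh.le (by positivity) ?_ ?_ ?_
    · simp [hY.2.1]
    · rw [hE]
      gcongr
    · intro m hm hem
      have hmN : ((m : ℝ) + 1) * h ≤ N * h :=
        mul_le_mul_of_nonneg_right (by exact_mod_cast hm) hh.le
      have hsub : Set.Icc (t₀ + m * h) (t₀ + (m + 1) * h) ⊆ Set.Icc t₀ T :=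
        Set.Icc_subset_Icc (le_add_of_nonneg_right (by positivity)) (by linarith)
      have hlen : t₀ + (m + 1) * h - (t₀ + m * h) = h := by ring
      have := (hY.2.2 m hm).norm_sub_le (hY.orthonormal hm.le) (by linarith) (abs_nonneg B)
        (abs_nonneg L) (fun t ht Z => (hF t (hsub ht) Z).trans (le_abs_self B))
        (fun t ht Z Z' => (hLip t (hsub ht) Z Z').trans
          (mul_le_mul_of_nonneg_right (le_abs_self L) (norm_nonneg _)))
        (fun t ht => (hA t (hsub ht)).mono hsub) (fun i t ht => hdec i t (hsub ht))
        (by rw [hlen]; linarith)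
      rw [hlen] at this
      push_cast
      refine this.trans (le_of_eq ?_)
      rw [hc]
      ring
  have h₁ : 0 ≤ (2 * (d : ℝ) + 2) * |B| * h := by positivity
  nlinarith
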